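/- Let $(C,d)$ be a complete CAT(0) space, that is, a complete geodesic metric space in which distances between points on two edges of any geodesic triangle are at most the distances between the corresponding points of a comparison triangle in the Euclidean plane. For $x,y\in C$ and $\alpha\in(0,1)$ let $\alpha x+(1-\alpha)y$ denote the (unique) point $z$ of the metric segment $[x,y]$ with $d(x,z)=(1-\alpha)d(x,y)$ and $d(z,y)=\alpha d(x,y)$, and for $K\subseteq C$ let $P_K(x)=\{y\in K: d(x,y)=\inf_{z\in K}d(x,z)\}$; when this set is a singleton it is identified with its element. Assume that $C$ has the N-property: whenever $K\subseteq C$ is nonempty, closed and convex, and $x_1,x_2\in C$ satisfy $P_K(x_1)=P_K(x_2)=p$, then $P_K(\alpha x_1+(1-\alpha)x_2)=p$ for all $\alpha\in(0,1)$. Let $T\colon C\to C$ be nonexpansive, i.e. $d(Tx,Ty)\le d(x,y)$ for all $x,y\in C$, with $\operatorname{Fix}T=\{x\in C: Tx=x\}\ne\emptyset$, and let $f\colon C\to C$ satisfy $d(f(x),f(y))\le k\,d(x,y)$ for all $x,y\in C$, where $0\le k<\frac12$. Then there is a unique $q\in\operatorname{Fix}T$ with $P_{\operatorname{Fix}T}(f(q))=q$.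 Moreover, for every $u\in C$ and all real sequences $(b_n)_{n\ge0}$, $(t_n)_{n\ge0}$ such that (i) $b_n,t_n\in(0,1)$ for all $n$; (ii) $0<\liminf_{n\to\infty} b_n\le\limsup_{n\to\infty} b_n<1$; (iii) $\lim_{n\to\infty}t_n=0$; (iv) $\sum_{n=0}^\infty t_n=\infty$, the sequence $(x_n)$ defined by $x_0=u$ and, for $n\ge0$, $$y_n=t_nf(x_n)+(1-t_n)T(x_n),\qquad x_{n+1}=b_nx_n+(1-b_n)y_n,$$ converges to $q$. -/

import Mathlib

open Filter Topology

namespace ViscosityCAT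

universe u

/-- `S` is a metric segment from `x` to `y`: the image of `[0, d(x,y)]` under an isometric
embedding that sends `0` to `x` and `d(x,y)` to `y`. -/
def IsMetricSegment {X : Type u} [MetricSpace X] (x y : X) (S : Set X) : Prop :=
  ∃ φ : ℝ → X, φ 0 = x ∧ φ (dist x y) = y ∧
    (∀ s ∈ Set.Icc (0 : ℝ) (dist x y), ∀ t ∈ Set.Icc (0 : ℝ) (dist x y),
      dist (φ s) (φ t) = |s - t|) ∧
    S = φ '' Set.Icc (0 : ℝ) (dist x y)

/-- A geodesic space: any two points are joined by a metric segment. -/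
def IsGeodesicSpace (X : Type u) [MetricSpace X] : Prop :=
  ∀ x y : X, ∃ S : Set X, IsMetricSegment x y S

/-- The Euclidean plane, the model space of curvature `0`. -/
abbrev Plane : Type := EuclideanSpace ℝ (Fin 2)

/-- The points `a₁, a₂, a₃` of the plane are the vertices of a comparison triangle of a geodesic
triangle with vertices `x₁, x₂, x₃`. -/
def IsComparisonTriangle {X : Type u} [MetricSpace X] (x₁ x₂ x₃ : X) (a₁ a₂ a₃ : Plane) : Prop :=
  dist a₁ a₂ = dist x₁ x₂ ∧ dist a₂ a₃ = dist x₂ x₃ ∧ dist a₃ a₁ = dist x₃ x₁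

/-- A CAT(0) space: a geodesic space in which, for all points `y₁`, `y₂` on two edges of a geodesic
triangle (with common vertex `x₁`) and their comparison points `c₁`, `c₂` on the edges of a
comparison triangle, the distance of `y₁` and `y₂` is at most that of `c₁` and `c₂`. -/
def IsCATZero (X : Type u) [MetricSpace X] : Prop :=
  IsGeodesicSpace X ∧
    ∀ (x₁ x₂ x₃ : X) (S₁₂ S₁₃ S₂₃ : Set X),
      IsMetricSegment x₁ x₂ S₁₂ → IsMetricSegment x₁ x₃ S₁₃ → IsMetricSegment x₂ x₃ S₂₃ →
      ∀ a₁ a₂ a₃ : Plane, IsComparisonTriangle x₁ x₂ x₃ a₁ a₂ a₃ →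
      ∀ y₁ ∈ S₁₂, ∀ y₂ ∈ S₁₃,
      ∀ c₁ ∈ segment ℝ a₁ a₂, ∀ c₂ ∈ segment ℝ a₁ a₃,
        dist a₁ c₁ = dist x₁ y₁ → dist a₁ c₂ = dist x₁ y₂ →
        dist y₁ y₂ ≤ dist c₁ c₂

/-- `z = α x + (1 - α) y`: the point `z` lies on a metric segment from `x` to `y`, with
`d(x,z) = (1 - α) d(x,y)` and `d(z,y) = α d(x,y)`. -/
def IsConvexComb {X : Type u} [MetricSpace X] (α : ℝ) (x y z : X) : Prop :=
  ∃ S : Set X, IsMetricSegment x y S ∧ z ∈ S ∧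
    dist x z = (1 - α) * dist x y ∧ dist z y = α * dist x y

/-- A set that contains every metric segment between any two of its points. -/
def IsGeodesicallyConvex {X : Type u} [MetricSpace X] (K : Set X) : Prop :=
  ∀ x ∈ K, ∀ y ∈ K, ∀ S : Set X, IsMetricSegment x y S → S ⊆ K

/-- The metric projection `P_K(x)`, as the set of the points of `K` nearest to `x`. -/
def metricProj {X : Type u} [MetricSpace X] (K : Set X) (x : X) : Set X :=
  {y | y ∈ K ∧ dist x y = Metric.infDist x K}

/-- The N-property (for curvature bound `0`): if two points have the same projection `p` onto a
closed convex set `K`, then so has every point `α x₁ + (1 - α) x₂` with `α ∈ (0,1)`. -/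
def HasNProperty (X : Type u) [MetricSpace X] : Prop :=
  ∀ K : Set X, IsClosed K → IsGeodesicallyConvex K →
    ∀ x₁ x₂ p : X, metricProj K x₁ = {p} → metricProj K x₂ = {p} →
      ∀ α ∈ Set.Ioo (0 : ℝ) 1, ∀ z : X, IsConvexComb α x₁ x₂ z → metricProj K z = {p}

/-- Both sequences lie in `(0,1)`, `b` stays away from `0` and `1` in the limit, and `t` tends to
`0` with divergent sum. -/
structure AdmissibleParameters (b t : ℕ → ℝ) : Prop where
  b_mem : ∀ n, b n ∈ Set.Ioo (0 : ℝ) 1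
  t_mem : ∀ n, t n ∈ Set.Ioo (0 : ℝ) 1
  liminf_pos : 0 < liminf b atTop
  limsup_lt_one : limsup b atTop < 1
  t_tendsto : Tendsto t atTop (𝓝 0)
  t_sum : Tendsto (fun n => ∑ i ∈ Finset.range n, t i) atTop atTop

/-- `x`, with auxiliary sequence `y`, is the viscosity iteration of `T` and `f` started at `u`
(with indices from `0`): `yₙ = tₙ f(xₙ) + (1 - tₙ) T(xₙ)` and `xₙ₊₁ = bₙ xₙ + (1 - bₙ) yₙ`. -/
structure IsViscosityIteration {X : Type u} [MetricSpace X] (T f : X → X) (b t : ℕ → ℝ) (u : X)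
    (x y : ℕ → X) : Prop where
  start : x 0 = u
  y_eq : ∀ n, IsConvexComb (t n) (f (x n)) (T (x n)) (y n)
  x_succ : ∀ n, IsConvexComb (b n) (x n) (y n) (x (n + 1))

end ViscosityCAT

/-!
The proof rests on one inequality, `IsCATZero.sq_dist_le`, which writes out the CAT(0) comparison
for points dividing two edges of a triangle in given ratios. It contains the
Bruhat–Tits inequality `IsConvexComb.sq_dist_le` (squared distance functions are uniformly convex
along segments) and the contraction of segments towards a common end, `IsConvexComb.dist_le`.

*Minimisation.* A continuous, bounded below function `g` satisfying the Bruhat–Tits inequality on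
a closed set `K` has a minimiser `c`, and `g c + d(c, z)² ≤ g z` on `K`
(`exists_forall_add_sq_dist_le`). With `g = d(w, ·)²` and `K = Fix T` this yields the metric
projection and its variational inequality; the projection is therefore nonexpansive, and Banach's
theorem for `P ∘ f` gives `q`. With `g z = lim d(xₙ, z)²` along an ultrafilter and `K` the
whole space it yields the asymptotic centre `c` of a bounded sequence. If `d(xₙ, T xₙ) → 0`, then
`c` is fixed by `T`, and `d(c, w)² ≤ lim d(xₙ, w)²`. Hence almost fixed points of `T` in a bounded
set are not much closer to `w` than `Fix T` is (`exists_forall_sq_dist_sub_lt`).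

*Convergence.* Put `w = f q`, `aₙ = d(xₙ, q)²`. Comparing `yₙ` with `tₙ w + (1 - tₙ) T xₙ` gives
`d(yₙ, q)² ≤ (1 - (1 - 2k) tₙ) aₙ + tₙ (d(w, q)² - d(w, T xₙ)²) + O(tₙ²)`, and
`aₙ₊₁ ≤ bₙ aₙ + (1 - bₙ) d(yₙ, q)² - bₙ (1 - bₙ) d(xₙ, yₙ)²`.
Suppose `aₙ ≥ e > 0`. If `xₙ` is almost fixed, then `d(w, q)² - d(w, T xₙ)²` is at most a small
positive number and, since `2k < 1`, the first inequality makes `aₙ` drop by a multiple of `tₙ`. If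
it is not, `d(xₙ, yₙ)` is bounded below and the last term of the second inequality makes it drop
by a constant. As `∑ tₙ = ∞` and `tₙ → 0`, the sequence `aₙ` has to enter every interval `[0, e)`
and cannot leave `[0, 2e)` afterwards (`tendsto_zero_of_decrease`).
-/

namespace ViscosityCAT

/-! ### Comparison triangles and segments -/

section Comparison

variable {X : Type*} [MetricSpace X]

theorem exists_isComparisonTriangle (x₁ x₂ x₃ : X) :
    ∃ a₁ a₂ a₃ : Plane, IsComparisonTriangle x₁ x₂ x₃ a₁ a₂ a₃ := by
  unfold IsComparisonTriangle
  have h₁ := dist_triangle x₁ x₂ x₃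
  have h₂ := dist_triangle x₂ x₃ x₁
  have h₃ := dist_triangle x₃ x₁ x₂
  rw [dist_comm x₁ x₃] at h₁
  rw [dist_comm x₂ x₁] at h₂
  rw [dist_comm x₃ x₂] at h₃
  have hc : 0 ≤ dist x₁ x₂ := dist_nonneg
  have ha : 0 ≤ dist x₂ x₃ := dist_nonneg
  have hb : 0 ≤ dist x₃ x₁ := dist_nonneg
  generalize dist x₁ x₂ = c at *
  generalize dist x₂ x₃ = a at *
  generalize dist x₃ x₁ = b at *
  obtain ⟨u, hu, hub⟩ : ∃ u : ℝ, 2 * c * u = b ^ 2 + c ^ 2 - a ^ 2 ∧ u ^ 2 ≤ b ^ 2 := by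
    rcases hc.eq_or_lt with rfl | hc
    · have : a = b := by linarith
      exact ⟨0, by subst this; ring, by simpa using sq_nonneg b⟩
    · refine ⟨(b ^ 2 + c ^ 2 - a ^ 2) / (2 * c), by field_simp, sq_le_sq' ?_ ?_⟩
      · rw [le_div_iff₀ (by positivity)]
        nlinarith
      · rw [div_le_iff₀ (by positivity)]
        nlinarith
  have hv : √(b ^ 2 - u ^ 2) ^ 2 = b ^ 2 - u ^ 2 := Real.sq_sqrt (by linarith)
  refine ⟨!₂[0, 0], !₂[c, 0], !₂[u, √(b ^ 2 - u ^ 2)], ?_, ?_, ?_⟩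
  · rw [EuclideanSpace.dist_eq, Real.sqrt_eq_iff_mul_self_eq (by positivity) hc]
    simp [Real.dist_eq, sq_abs]
    ring
  · rw [EuclideanSpace.dist_eq, Real.sqrt_eq_iff_mul_self_eq (by positivity) ha]
    simp [Real.dist_eq, sq_abs, hv]
    linarith
  · rw [EuclideanSpace.dist_eq, Real.sqrt_eq_iff_mul_self_eq (by positivity) hb]
    simp [Real.dist_eq, sq_abs, hv]
    ring

theorem IsMetricSegment.symm {x y : X} {S : Set X} (h : IsMetricSegment x y S) :
    IsMetricSegment y x S := by
  obtain ⟨φ, h0, h1, hφ, rfl⟩ := h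
  refine ⟨fun s => φ (dist x y - s), by simpa using h1, by simpa [dist_comm y x] using h0, ?_, ?_⟩
  · intro s hs t ht
    rw [dist_comm y x, Set.mem_Icc] at hs ht
    rw [hφ _ ⟨by linarith, by linarith⟩ _ ⟨by linarith, by linarith⟩,
      show dist x y - s - (dist x y - t) = t - s by ring, abs_sub_comm]
  · rw [dist_comm y x]
    ext z
    constructor
    · rintro ⟨s, hs, rfl⟩
      exact ⟨dist x y - s, ⟨by linarith [hs.2], by linarith [hs.1]⟩, by simp⟩
    · rintro ⟨s, hs, rfl⟩
      exact ⟨dist x y - s, ⟨by linarith [hs.2], by linarith [hs.1]⟩, rfl⟩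

theorem IsMetricSegment.right_mem {x y : X} {S : Set X} (h : IsMetricSegment x y S) : y ∈ S := by
  obtain ⟨φ, -, h1, -, rfl⟩ := h
  exact ⟨_, Set.right_mem_Icc.2 dist_nonneg, h1⟩

theorem IsGeodesicSpace.exists_isConvexComb (h : IsGeodesicSpace X) {α : ℝ}
    (hα : α ∈ Set.Icc (0 : ℝ) 1) (x y : X) : ∃ z, IsConvexComb α x y z := by
  obtain ⟨S, hS⟩ := h x y
  obtain ⟨φ, h0, h1, hφ, rfl⟩ := hS
  have hd : 0 ≤ dist x y := dist_nonneg
  have hm : (1 - α) * dist x y ∈ Set.Icc 0 (dist x y) :=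
    ⟨mul_nonneg (by linarith [hα.2]) hd, by nlinarith [hα.1]⟩
  refine ⟨φ ((1 - α) * dist x y), _, ⟨φ, h0, h1, hφ, rfl⟩, ⟨_, hm, rfl⟩, ?_, ?_⟩
  · have := hφ 0 (Set.left_mem_Icc.2 hd) _ hm
    rwa [h0, zero_sub, abs_neg, abs_of_nonneg hm.1] at this
  · have := hφ _ hm _ (Set.right_mem_Icc.2 hd)
    rw [h1, abs_sub_comm, abs_of_nonneg (by linarith [hm.2])] at this
    rw [this]
    ring

/-- The CAT(0) inequality for points dividing the edges `[x₁, x₂]` and `[x₁, x₃]` in the ratios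
`s` and `r`; the right-hand side is the law of cosines in the comparison triangle. -/
theorem IsCATZero.sq_dist_le (hX : IsCATZero X) {x₁ x₂ x₃ y₁ y₂ : X} {S₁₂ S₁₃ : Set X}
    (h₁₂ : IsMetricSegment x₁ x₂ S₁₂) (h₁₃ : IsMetricSegment x₁ x₃ S₁₃) (hy₁ : y₁ ∈ S₁₂)
    (hy₂ : y₂ ∈ S₁₃) {s r : ℝ} (hs : s ∈ Set.Icc (0 : ℝ) 1) (hr : r ∈ Set.Icc (0 : ℝ) 1)
    (hd₁ : dist x₁ y₁ = s * dist x₁ x₂) (hd₂ : dist x₁ y₂ = r * dist x₁ x₃) :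
    dist y₁ y₂ ^ 2 ≤ s ^ 2 * dist x₁ x₂ ^ 2 + r ^ 2 * dist x₁ x₃ ^ 2
      - s * r * (dist x₁ x₂ ^ 2 + dist x₁ x₃ ^ 2 - dist x₂ x₃ ^ 2) := by
  obtain ⟨S₂₃, h₂₃⟩ := hX.1 x₂ x₃
  obtain ⟨a₁, a₂, a₃, ha⟩ := exists_isComparisonTriangle x₁ x₂ x₃
  have key := hX.2 x₁ x₂ x₃ S₁₂ S₁₃ S₂₃ h₁₂ h₁₃ h₂₃ a₁ a₂ a₃ ha y₁ hy₁ y₂ hy₂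
    (AffineMap.lineMap a₁ a₂ s) (lineMap_mem_segment ℝ a₁ a₂ hs)
    (AffineMap.lineMap a₁ a₃ r) (lineMap_mem_segment ℝ a₁ a₃ hr)
    (by rw [dist_left_lineMap, ha.1, hd₁, Real.norm_of_nonneg hs.1])
    (by rw [dist_left_lineMap, dist_comm a₁, ha.2.2, hd₂, Real.norm_of_nonneg hr.1,
      dist_comm x₃])
  refine (pow_le_pow_left₀ dist_nonneg key 2).trans (le_of_eq ?_)
  rw [← ha.1, ← ha.2.1, dist_comm x₁ x₃, ← ha.2.2, dist_comm a₁ a₂, dist_eq_norm, dist_eq_norm,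
    dist_eq_norm, dist_eq_norm]
  have e₁ : (AffineMap.lineMap a₁ a₂ s : Plane) - AffineMap.lineMap a₁ a₃ r
      = s • (a₂ - a₁) - r • (a₃ - a₁) := by
    simp [AffineMap.lineMap_apply]
  have e₂ : a₂ - a₃ = (a₂ - a₁) - (a₃ - a₁) := by abel
  rw [e₁, e₂]
  generalize a₂ - a₁ = v
  generalize a₃ - a₁ = w
  rw [norm_sub_sq_real, norm_sub_sq_real, norm_smul, norm_smul, real_inner_smul_left,
    real_inner_smul_right, mul_pow, mul_pow, Real.norm_eq_abs, Real.norm_eq_abs, sq_abs, sq_abs]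
  ring

/-- The Bruhat–Tits inequality. -/
theorem IsConvexComb.sq_dist_le (hX : IsCATZero X) {α : ℝ} (hα : α ∈ Set.Icc (0 : ℝ) 1)
    {x y z : X} (h : IsConvexComb α x y z) (p : X) :
    dist z p ^ 2 ≤ α * dist x p ^ 2 + (1 - α) * dist y p ^ 2 - α * (1 - α) * dist x y ^ 2 := by
  obtain ⟨S, hS, hz, hd, -⟩ := h
  obtain ⟨S', hS'⟩ := hX.1 x p
  have := hX.sq_dist_le hS hS' hz hS'.right_mem (s := 1 - α) (r := 1)
    ⟨by linarith [hα.2], by linarith [hα.1]⟩ ⟨by norm_num, le_rfl⟩ hd (by ring)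
  linarith

theorem IsConvexComb.dist_le (hX : IsCATZero X) {α : ℝ} (hα : α ∈ Set.Icc (0 : ℝ) 1)
    {x x' y z z' : X} (h : IsConvexComb α x y z) (h' : IsConvexComb α x' y z') :
    dist z z' ≤ α * dist x x' := by
  obtain ⟨S, hS, hz, -, hd⟩ := h
  obtain ⟨S', hS', hz', -, hd'⟩ := h'
  have := hX.sq_dist_le hS.symm hS'.symm hz hz' hα hα
    (by rw [dist_comm, hd, dist_comm]) (by rw [dist_comm, hd', dist_comm])
  refine le_of_sq_le_sq ?_ (mul_nonneg hα.1 dist_nonneg)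
  linarith

/-- The distance to a point is convex along segments. -/
theorem IsConvexComb.dist_le_add (hX : IsCATZero X) {α : ℝ} (hα : α ∈ Set.Icc (0 : ℝ) 1)
    {x y z : X} (h : IsConvexComb α x y z) (p : X) :
    dist z p ≤ α * dist x p + (1 - α) * dist y p := by
  have hα' : 0 ≤ 1 - α := by linarith [hα.2]
  refine le_of_sq_le_sq ?_ (add_nonneg (mul_nonneg hα.1 dist_nonneg)
    (mul_nonneg hα' dist_nonneg))
  have h₁ := h.sq_dist_le hX hα p
  have h₂ : (dist x p - dist y p) ^ 2 ≤ dist x y ^ 2 :=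
    sq_le_sq' (by linarith [dist_triangle_left y p x])
      (by linarith [dist_triangle x y p])
  nlinarith [mul_le_mul_of_nonneg_left h₂ (mul_nonneg hα.1 hα')]

/-- Squared diagonals of a quadrilateral sum to at most the sum of the squared sides. -/
theorem IsCATZero.quadrilateral (hX : IsCATZero X) (x y p p' : X) :
    dist x p' ^ 2 + dist y p ^ 2 ≤
      dist x p ^ 2 + dist y p' ^ 2 + dist x y ^ 2 + dist p p' ^ 2 := by
  have hα : (1 / 2 : ℝ) ∈ Set.Icc (0 : ℝ) 1 := by norm_num
  obtain ⟨m, hm⟩ := hX.1.exists_isConvexComb hα x p'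
  have h₁ := hm.sq_dist_le hX hα y
  have h₂ := hm.sq_dist_le hX hα p
  have h₃ := dist_triangle_left y p m
  rw [dist_comm p' y] at h₁
  rw [dist_comm p' p] at h₂
  nlinarith [pow_le_pow_left₀ dist_nonneg h₃ 2, sq_nonneg (dist m y - dist m p)]

end Comparison

/-! ### Minimisers, projections and asymptotic centres -/

section Minimiser

variable {X : Type*} [MetricSpace X] [CompleteSpace X]

/-- A minimising sequence is Cauchy, because the values at midpoints cannot be below the infimum.
The quadratic growth at the minimiser `c` results from comparing `c` with points of `[c, z]`
close to `c`. -/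
theorem exists_forall_add_sq_dist_le {K : Set X} (hK : IsClosed K) (hne : K.Nonempty) {g : X → ℝ}
    (hg : Continuous g) (h0 : ∀ z, 0 ≤ g z)
    (hconv : ∀ x ∈ K, ∀ y ∈ K, ∀ α ∈ Set.Ioo (0 : ℝ) 1,
      ∃ z ∈ K, g z ≤ α * g x + (1 - α) * g y - α * (1 - α) * dist x y ^ 2) :
    ∃ c ∈ K, ∀ z ∈ K, g c + dist c z ^ 2 ≤ g z := by
  set m := sInf (g '' K) with hm
  have hbdd : BddBelow (g '' K) := ⟨0, by rintro _ ⟨z, -, rfl⟩; exact h0 z⟩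
  have hle : ∀ z ∈ K, m ≤ g z := fun z hz => csInf_le hbdd ⟨z, hz, rfl⟩
  have hex : ∀ n : ℕ, ∃ z ∈ K, g z < m + 1 / ((n : ℝ) + 1) := by
    intro n
    obtain ⟨_, ⟨z, hz, rfl⟩, hlt⟩ := exists_lt_of_csInf_lt (hne.image g)
      (show sInf (g '' K) < m + 1 / ((n : ℝ) + 1) from by
        rw [← hm]; linarith [Nat.one_div_pos_of_nat (α := ℝ) (n := n)])
    exact ⟨z, hz, hlt⟩
  choose z hzK hz using hex
  have hlim : Tendsto (fun n : ℕ => m + 1 / ((n : ℝ) + 1)) atTop (𝓝 m) := by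
    simpa using tendsto_one_div_add_atTop_nhds_zero_nat.const_add m
  have hcau : CauchySeq z := by
    rw [Metric.cauchySeq_iff]
    intro ε hε
    obtain ⟨N, hN⟩ := eventually_atTop.1
      (hlim.eventually_lt_const (show m < m + ε ^ 2 / 4 by linarith [pow_pos hε 2]))
    refine ⟨N, fun i hi j hj => ?_⟩
    obtain ⟨w, hwK, hw⟩ := hconv _ (hzK i) _ (hzK j) (1 / 2) (by norm_num)
    have := hle w hwK
    have := (hz i).trans (hN i hi)
    have := (hz j).trans (hN j hj)
    exact lt_of_pow_lt_pow_left₀ 2 hε.le (by linarith)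
  obtain ⟨c, hc⟩ := cauchySeq_tendsto_of_complete hcau
  have hcK : c ∈ K := hK.mem_of_tendsto hc (Eventually.of_forall hzK)
  have hcm : g c = m := le_antisymm
    (le_of_tendsto_of_tendsto' ((hg.tendsto c).comp hc) hlim fun n => (hz n).le) (hle c hcK)
  refine ⟨c, hcK, fun y hy => ?_⟩
  have hl : Tendsto (fun s : ℝ => g y - (1 - s) * dist c y ^ 2) (𝓝[>] 0)
      (𝓝 (g y - (1 - 0) * dist c y ^ 2)) :=
    ((by fun_prop : Continuous fun s : ℝ => g y - (1 - s) * dist c y ^ 2).tendsto 0).mono_left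
      nhdsWithin_le_nhds
  have : g c ≤ g y - (1 - 0) * dist c y ^ 2 := by
    refine ge_of_tendsto hl ?_
    filter_upwards [Ioo_mem_nhdsGT (zero_lt_one' ℝ)] with s hs
    obtain ⟨w, hwK, hw⟩ := hconv c hcK y hy (1 - s) ⟨by linarith [hs.2], by linarith [hs.1]⟩
    have h₁ := hle w hwK
    rw [← hcm] at h₁
    have : s * g c ≤ s * (g y - (1 - s) * dist c y ^ 2) := by linarith
    exact le_of_mul_le_mul_left this hs.1
  linarith

theorem isConvexComb_mem_fixedPoints {X : Type*} [MetricSpace X] (hX : IsCATZero X) {T : X → X}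
    (hT : LipschitzWith 1 T) {α : ℝ} (hα : α ∈ Set.Icc (0 : ℝ) 1) {x y z : X}
    (hx : x ∈ Function.fixedPoints T) (hy : y ∈ Function.fixedPoints T)
    (h : IsConvexComb α x y z) : z ∈ Function.fixedPoints T := by
  have h₁ := h.sq_dist_le hX hα (T z)
  obtain ⟨S, -, -, hd, hd'⟩ := h
  have hx' : dist x (T z) ≤ (1 - α) * dist x y := by
    have := hT.dist_le_mul x z
    rwa [hx.eq, NNReal.coe_one, one_mul, hd] at this
  have hy' : dist y (T z) ≤ α * dist x y := by
    have := hT.dist_le_mul y z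
    rwa [hy.eq, NNReal.coe_one, one_mul, dist_comm y z, hd'] at this
  have h₂ := mul_le_mul_of_nonneg_left (pow_le_pow_left₀ dist_nonneg hx' 2) hα.1
  have h₃ := mul_le_mul_of_nonneg_left (pow_le_pow_left₀ dist_nonneg hy' 2)
    (sub_nonneg.2 hα.2)
  have h₄ : dist z (T z) ^ 2 ≤ 0 := by linarith
  have h₅ : dist z (T z) = 0 := pow_eq_zero_iff two_ne_zero |>.1 (le_antisymm h₄ (sq_nonneg _))
  exact (dist_eq_zero.1 h₅).symm

/-- The metric projection onto `Fix T`, with its variational inequality. -/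
theorem exists_projection_fixedPoints (hX : IsCATZero X) {T : X → X} (hT : LipschitzWith 1 T)
    (hFix : (Function.fixedPoints T).Nonempty) (w : X) :
    ∃ p ∈ Function.fixedPoints T,
      ∀ z ∈ Function.fixedPoints T, dist p w ^ 2 + dist p z ^ 2 ≤ dist z w ^ 2 := by
  refine exists_forall_add_sq_dist_le (g := fun z => dist z w ^ 2)
    (isClosed_fixedPoints hT.continuous) hFix (by fun_prop) (fun _ => sq_nonneg _) ?_
  intro x hx y hy α hα
  have hα' := Set.Ioo_subset_Icc_self hα
  obtain ⟨z, hz⟩ := hX.1.exists_isConvexComb hα' x y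
  exact ⟨z, isConvexComb_mem_fixedPoints hX hT hα' hx hy hz, hz.sq_dist_le hX hα' w⟩

/-- The asymptotic centre `c` of a bounded sequence, with respect to an ultrafilter. -/
theorem exists_asymptotic_center (hX : IsCATZero X) {ι : Type*} (U : Ultrafilter ι) {x : ι → X}
    {q : X} {R : ℝ} (hx : ∀ n, dist (x n) q ≤ R) :
    ∃ (ρ : X → ℝ) (c : X), (∀ z, Tendsto (fun n => dist (x n) z) U (𝓝 (ρ z))) ∧
      ∀ z, ρ c ^ 2 + dist c z ^ 2 ≤ ρ z ^ 2 := by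
  have hlim : ∀ z, ∃ r : ℝ, Tendsto (fun n => dist (x n) z) U (𝓝 r) := by
    intro z
    obtain ⟨r, -, hr⟩ := (isCompact_Icc (a := (0 : ℝ)) (b := R + dist q z)).ultrafilter_le_nhds
      (U.map fun n => dist (x n) z) (by
        rw [le_principal_iff, Ultrafilter.mem_coe, Ultrafilter.mem_map]
        exact Filter.univ_mem' fun n =>
          ⟨dist_nonneg, by linarith [dist_triangle (x n) q z, hx n]⟩)
    exact ⟨r, hr⟩
  choose ρ hρ using hlim
  have hρ0 : ∀ z, 0 ≤ ρ z := fun z => ge_of_tendsto' (hρ z) fun n => dist_nonneg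
  have hcont : Continuous ρ := by
    refine (LipschitzWith.of_le_add fun z z' => ?_).continuous
    refine le_of_tendsto_of_tendsto' (hρ z) ((hρ z').add_const (dist z z')) fun n => ?_
    exact dist_comm z' z ▸ dist_triangle (x n) z' z
  have : Nonempty X := ⟨q⟩
  obtain ⟨c, -, hc⟩ := exists_forall_add_sq_dist_le (K := Set.univ) (g := fun z => ρ z ^ 2)
    isClosed_univ Set.univ_nonempty (hcont.pow 2) (fun _ => sq_nonneg _) (by
      intro a _ b _ α hα
      have hα' := Set.Ioo_subset_Icc_self hα
      obtain ⟨z, hz⟩ := hX.1.exists_isConvexComb hα' a b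
      refine ⟨z, trivial, ?_⟩
      refine le_of_tendsto_of_tendsto' ((hρ z).pow 2)
        (((((hρ a).pow 2).const_mul α).add (((hρ b).pow 2).const_mul (1 - α))).sub_const
          (α * (1 - α) * dist a b ^ 2)) fun n => ?_
      have := hz.sq_dist_le hX hα' (x n)
      rwa [dist_comm z, dist_comm a (x n), dist_comm b (x n)] at this)
  exact ⟨ρ, c, hρ, fun z => hc z trivial⟩

/-- A uniform demiclosedness principle: points of a bounded set that `T` moves little are not much
closer to `w` than `Fix T` is. A sequence of counterexamples would have an asymptotic centre that
is fixed by `T` and too close to `w`. -/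
theorem exists_forall_sq_dist_sub_lt (hX : IsCATZero X) {T : X → X} (hT : LipschitzWith 1 T)
    {w q : X} {A : ℝ} (hA : ∀ z ∈ Function.fixedPoints T, A ≤ dist z w ^ 2) (R : ℝ) {ε : ℝ}
    (hε : 0 < ε) :
    ∃ η > 0, ∀ x, dist x q ≤ R → dist x (T x) < η → A - ε < dist x w ^ 2 := by
  by_contra! hcon
  choose x hxR hxT hxw using fun n : ℕ => hcon (1 / ((n : ℝ) + 1)) Nat.one_div_pos_of_nat
  obtain ⟨ρ, c, hρ, hc⟩ := exists_asymptotic_center hX (hyperfilter ℕ) hxR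
  have hU : (hyperfilter ℕ : Filter ℕ) ≤ atTop := Nat.hyperfilter_le_atTop
  have hρ0 : 0 ≤ ρ (T c) := ge_of_tendsto' (hρ _) fun n => dist_nonneg
  have hTc : ρ (T c) ≤ 0 + ρ c := by
    refine le_of_tendsto_of_tendsto' (hρ (T c))
      ((tendsto_one_div_add_atTop_nhds_zero_nat (𝕜 := ℝ)).mono_left hU |>.add (hρ c)) fun n => ?_
    have h₁ := hT.dist_le_mul (x n) c
    rw [NNReal.coe_one, one_mul] at h₁
    linarith [dist_triangle (x n) (T (x n)) (T c), hxT n]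
  have hfix : c ∈ Function.fixedPoints T := by
    have h₁ := hc (T c)
    have h₂ := pow_le_pow_left₀ hρ0 hTc 2
    have h₃ : dist c (T c) ^ 2 ≤ 0 := by rw [zero_add] at h₂; linarith
    have h₄ : dist c (T c) = 0 := pow_eq_zero_iff two_ne_zero |>.1 (le_antisymm h₃ (sq_nonneg _))
    exact (dist_eq_zero.1 h₄).symm
  have hw : ρ w ^ 2 ≤ A - ε := le_of_tendsto' ((hρ w).pow 2) hxw
  linarith [hA c hfix, hc w, sq_nonneg (ρ c)]

end Minimiser

/-! ### A lemma on real sequences -/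

/-- If `a` drops by a multiple of `t` wherever it is not small, and never rises by more than a
multiple of `t`, then it tends to zero: the drops add up to infinity, and the rises tend to zero. -/
theorem tendsto_zero_of_decrease {a t : ℕ → ℝ} {M : ℝ} (ha : ∀ n, 0 ≤ a n)
    (ht : ∀ n, 0 < t n) (ht0 : Tendsto t atTop (𝓝 0))
    (hsum : Tendsto (fun n => ∑ i ∈ Finset.range n, t i) atTop atTop)
    (hstep : ∀ n, a (n + 1) ≤ a n + M * t n)
    (hdec : ∀ e > 0, ∃ γ > 0, ∀ᶠ n in atTop, e ≤ a n → a (n + 1) ≤ a n - γ * t n) :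
    Tendsto a atTop (𝓝 0) := by
  rw [Metric.tendsto_atTop]
  intro ε hε
  obtain ⟨γ, hγ, hγdec⟩ := hdec (ε / 2) (by linarith)
  have hMt : Tendsto (fun n => M * t n) atTop (𝓝 0) := by simpa using ht0.const_mul M
  obtain ⟨N, hN⟩ := eventually_atTop.1
    (hγdec.and (hMt.eventually_lt_const (show (0 : ℝ) < ε / 2 by linarith)))
  obtain ⟨m, hNm, hm⟩ : ∃ m ≥ N, a m < ε / 2 := by
    by_contra! hcon
    have hbound : ∀ n ≥ N, a n ≤
        a N - γ * (∑ i ∈ Finset.range n, t i - ∑ i ∈ Finset.range N, t i) := by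
      intro n hn
      induction n, hn using Nat.le_induction with
      | base => simp
      | succ n hn ih =>
        have := (hN n hn).1 (hcon n hn)
        rw [Finset.sum_range_succ]
        linarith
    obtain ⟨n, hn, hlt⟩ := ((eventually_ge_atTop N).and
      (hsum.eventually_gt_atTop (a N / γ + ∑ i ∈ Finset.range N, t i))).exists
    have h₁ := hbound n hn
    have h₂ : a N / γ < ∑ i ∈ Finset.range n, t i - ∑ i ∈ Finset.range N, t i := by linarith
    rw [div_lt_iff₀ hγ] at h₂
    linarith [ha n]
  refine ⟨m, fun n hn => ?_⟩
  rw [Real.dist_eq, sub_zero, abs_of_nonneg (ha n)]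
  induction n, hn using Nat.le_induction with
  | base => linarith
  | succ n hn ih =>
    obtain ⟨h₁, h₂⟩ := hN n (hNm.trans hn)
    rcases lt_or_ge (a n) (ε / 2) with h | h
    · linarith [hstep n]
    · linarith [h₁ h, mul_pos hγ (ht n)]

/-! ### Convergence of the viscosity iteration -/

section Iteration

variable {X : Type*} [MetricSpace X]

/-- One step of the iteration, seen from a fixed point `q` of `T`. -/
theorem sq_dist_viscosity_step_le (hX : IsCATZero X) {T f : X → X} (hT : LipschitzWith 1 T)
    {k : NNReal} (hk : (k : ℝ) < 1 / 2) (hf : LipschitzWith k f) {q : X}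
    (hq : q ∈ Function.fixedPoints T) {R t : ℝ} (ht : t ∈ Set.Ioo (0 : ℝ) 1)
    (hR : dist (f q) q ≤ R) {x y : X} (hx : dist x q ≤ R)
    (hy : IsConvexComb t (f x) (T x) y) :
    dist y q ^ 2 ≤ (1 - (1 - 2 * k) * t) * dist x q ^ 2 +
      t * (dist (f q) q ^ 2 - dist (T x) (f q) ^ 2 + 6 * R ^ 2 * t) := by
  have ht' := Set.Ioo_subset_Icc_self ht
  -- Comparing `y` with a point `y'` over the fixed anchor `f q` costs at most `t k d(x, q)`.
  obtain ⟨y', hy'⟩ := hX.1.exists_isConvexComb ht' (f q) (T x)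
  have h₁ := hy.dist_le hX ht' hy'
  have h₂ := hy'.sq_dist_le hX ht' q
  have h₃ := hy'.dist_le_add hX ht' q
  have hTx : dist (T x) q ≤ dist x q := by
    have := hT.dist_le_mul x q
    rwa [hq.eq, NNReal.coe_one, one_mul] at this
  have hfx := hf.dist_le_mul x q
  have hW : dist (T x) (f q) ≤ 2 * R := by
    linarith [dist_triangle_right (T x) (f q) q]
  have h₄ := dist_triangle y y' q
  rw [dist_comm (f q) (T x)] at h₂
  have hk0 : (0 : ℝ) ≤ k := k.2
  have hD0 : 0 ≤ dist x q := dist_nonneg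
  have hA0 : 0 ≤ dist (f q) q := dist_nonneg
  have hW0 : 0 ≤ dist (T x) (f q) := dist_nonneg
  have hE0 : 0 ≤ dist (T x) q := dist_nonneg
  have hP0 : 0 ≤ dist y' q := dist_nonneg
  have hY0 : 0 ≤ dist y q := dist_nonneg
  generalize dist x q = D at *
  generalize dist (f q) q = A at *
  generalize dist (T x) (f q) = W at *
  generalize dist (T x) q = E at *
  generalize dist y' q = P at *
  generalize dist y q = Y at *
  generalize (k : ℝ) = κ at *
  obtain ⟨ht0, ht1⟩ := ht
  have hYP : Y ≤ P + t * (κ * D) := by nlinarith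
  have hP : P ≤ D + t * R := by nlinarith
  have hP2 : P ^ 2 ≤ t * A ^ 2 + (1 - t) * D ^ 2 - t * (1 - t) * W ^ 2 := by
    have : E ^ 2 ≤ D ^ 2 := pow_le_pow_left₀ hE0 hTx 2
    nlinarith
  have hκD : 0 ≤ κ * D := mul_nonneg hk0 hD0
  have hκD' : κ * D ≤ R / 2 := by nlinarith
  have hW2 : W ^ 2 ≤ 4 * R ^ 2 := by nlinarith
  have hY2 : Y ^ 2 ≤ P ^ 2 + 2 * t * (κ * D) * P + t ^ 2 * (κ * D) ^ 2 := by
    have := pow_le_pow_left₀ hY0 hYP 2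
    linarith
  have hcross : 2 * t * (κ * D) * P ≤ 2 * t * (κ * D) * (D + t * R) :=
    mul_le_mul_of_nonneg_left hP (by positivity)
  have hR0 : 0 ≤ R := hA0.trans hR
  have e₁ : t ^ 2 * (κ * D * R) ≤ t ^ 2 * (R / 2 * R) := by gcongr
  have e₂ : t ^ 2 * (κ * D) ^ 2 ≤ t ^ 2 * (R / 2) ^ 2 := by gcongr
  have e₃ : t ^ 2 * W ^ 2 ≤ t ^ 2 * (4 * R ^ 2) := by gcongr
  nlinarith [mul_nonneg (sq_nonneg t) (sq_nonneg R)]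

/-- The iteration is bounded: the bound `R` satisfies `k R + d(f q, q) ≤ R` since `k < 1 / 2`. -/
theorem IsViscosityIteration.dist_le (hX : IsCATZero X) {T f : X → X} (hT : LipschitzWith 1 T)
    {k : NNReal} (hk : (k : ℝ) < 1 / 2) (hf : LipschitzWith k f) {q : X}
    (hq : q ∈ Function.fixedPoints T) {b t : ℕ → ℝ} (hbt : AdmissibleParameters b t) {u : X}
    {x y : ℕ → X} (h : IsViscosityIteration T f b t u x y) (n : ℕ) :
    dist (x n) q ≤ max (dist u q) (2 * dist (f q) q) := by
  induction n with
  | zero => rw [h.start]; exact le_max_left _ _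
  | succ n ih =>
    have hA := le_max_right (dist u q) (2 * dist (f q) q)
    generalize max (dist u q) (2 * dist (f q) q) = R at *
    have hb := hbt.b_mem n
    have ht := hbt.t_mem n
    have h₁ := (h.y_eq n).dist_le_add hX (Set.Ioo_subset_Icc_self ht) q
    have h₂ := (h.x_succ n).dist_le_add hX (Set.Ioo_subset_Icc_self hb) q
    have hTx := hT.dist_le_mul (x n) q
    rw [hq.eq, NNReal.coe_one, one_mul] at hTx
    have hfx := hf.dist_le_mul (x n) q
    have h₃ := dist_triangle (f (x n)) (f q) q
    have hkD : (k : ℝ) * dist (x n) q ≤ 1 / 2 * R :=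
      mul_le_mul hk.le ih dist_nonneg (by norm_num)
    have hy : dist (y n) q ≤ R := by
      nlinarith [mul_le_mul_of_nonneg_left (show dist (f (x n)) q ≤ R by linarith) ht.1.le,
        mul_le_mul_of_nonneg_left (hTx.trans ih) (sub_nonneg.2 ht.2.le)]
    nlinarith [mul_le_mul_of_nonneg_left ih hb.1.le,
      mul_le_mul_of_nonneg_left hy (sub_nonneg.2 hb.2.le)]

theorem AdmissibleParameters.exists_eventually_bounds {b t : ℕ → ℝ}
    (h : AdmissibleParameters b t) : ∃ c > 0, ∀ᶠ n in atTop, c ≤ b n ∧ c ≤ 1 - b n := by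
  have hlb : IsBoundedUnder (· ≥ ·) atTop b := isBoundedUnder_of ⟨0, fun n => (h.b_mem n).1.le⟩
  have hub : IsBoundedUnder (· ≤ ·) atTop b := isBoundedUnder_of ⟨1, fun n => (h.b_mem n).2.le⟩
  obtain ⟨c₁, hc₁, hc₁'⟩ := exists_between h.liminf_pos
  obtain ⟨c₂, hc₂, hc₂'⟩ := exists_between h.limsup_lt_one
  refine ⟨min c₁ (1 - c₂), lt_min hc₁ (by linarith), ?_⟩
  filter_upwards [eventually_lt_of_lt_liminf hc₁' hlb, eventually_lt_of_limsup_lt hc₂ hub]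
    with n h₁ h₂
  exact ⟨(min_le_left _ _).trans h₁.le, (min_le_right _ _).trans (by linarith)⟩

theorem IsViscosityIteration.tendsto [CompleteSpace X] (hX : IsCATZero X) {T f : X → X}
    (hT : LipschitzWith 1 T) {k : NNReal} (hk : (k : ℝ) < 1 / 2) (hf : LipschitzWith k f) {q : X}
    (hq : q ∈ Function.fixedPoints T)
    (hproj : ∀ z ∈ Function.fixedPoints T, dist q (f q) ^ 2 ≤ dist z (f q) ^ 2)
    {b t : ℕ → ℝ} (hbt : AdmissibleParameters b t) {u : X}
    {x y : ℕ → X} (h : IsViscosityIteration T f b t u x y) : Tendsto x atTop (𝓝 q) := by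
  obtain ⟨R, hR, hA⟩ : ∃ R, (∀ n, dist (x n) q ≤ R) ∧ dist (f q) q ≤ R :=
    ⟨_, h.dist_le hX hT hk hf hq hbt, by
      linarith [le_max_right (dist u q) (2 * dist (f q) q), dist_nonneg (x := f q) (y := q)]⟩
  have hR0 : 0 ≤ R := dist_nonneg.trans hA
  have hy := fun n => sq_dist_viscosity_step_le hX hT hk hf hq (hbt.t_mem n) hA (hR n) (h.y_eq n)
  have hx := fun n => (h.x_succ n).sq_dist_le hX (Set.Ioo_subset_Icc_self (hbt.b_mem n)) q
  have hA2 : dist (f q) q ^ 2 ≤ R ^ 2 := pow_le_pow_left₀ dist_nonneg hA 2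
  -- `yₙ` is no farther from `q` than `xₙ`, up to a multiple of `tₙ`.
  have hy' : ∀ n, dist (y n) q ^ 2 ≤ dist (x n) q ^ 2 + 7 * R ^ 2 * t n := by
    intro n
    obtain ⟨ht0, ht1⟩ := hbt.t_mem n
    have e₁ : 0 ≤ (1 - 2 * k) * t n * dist (x n) q ^ 2 :=
      mul_nonneg (mul_nonneg (by linarith) ht0.le) (sq_nonneg _)
    have e₂ := mul_nonneg ht0.le (sq_nonneg (dist (T (x n)) (f q)))
    have e₃ := mul_le_mul_of_nonneg_left hA2 ht0.le
    have e₄ : t n * (6 * R ^ 2 * t n) ≤ t n * (6 * R ^ 2 * 1) := by gcongr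
    linarith [hy n]
  have hsq : Tendsto (fun n => dist (x n) q ^ 2) atTop (𝓝 0) := by
    refine tendsto_zero_of_decrease (M := 7 * R ^ 2) (fun n => sq_nonneg _)
      (fun n => (hbt.t_mem n).1) hbt.t_tendsto hbt.t_sum (fun n => ?_) (fun e he => ?_)
    · obtain ⟨hb0, hb1⟩ := hbt.b_mem n
      have e₁ := mul_le_mul_of_nonneg_left (hy' n) (sub_nonneg.2 hb1.le)
      have e₂ : 0 ≤ b n * (1 - b n) * dist (x n) (y n) ^ 2 :=
        mul_nonneg (mul_nonneg hb0.le (sub_nonneg.2 hb1.le)) (sq_nonneg _)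
      have e₃ : 0 ≤ b n * (7 * R ^ 2 * t n) :=
        mul_nonneg hb0.le (mul_nonneg (by positivity) (hbt.t_mem n).1.le)
      linarith [hx n]
    obtain ⟨c, hc, hbc⟩ := hbt.exists_eventually_bounds
    have hκ : 0 < 1 - 2 * (k : ℝ) := by linarith
    set κ := 1 - 2 * (k : ℝ) with hκdef
    have hκe : 0 < κ * e := mul_pos hκ he
    obtain ⟨η, hη, hdemi⟩ := exists_forall_sq_dist_sub_lt hX hT (q := q) hproj R
      (show 0 < κ * e / 4 by linarith)
    refine ⟨c * (κ * e / 2), by positivity, ?_⟩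
    have small : ∀ B δ : ℝ, 0 < δ → ∀ᶠ n in atTop, B * t n < δ := fun B δ hδ =>
      (by simpa using hbt.t_tendsto.const_mul B :
        Tendsto (fun n => B * t n) atTop (𝓝 0)).eventually_lt_const hδ
    filter_upwards [hbc, small (6 * R ^ 2) (κ * e / 4) (by linarith),
      small (3 * R) (η / 2) (by linarith),
      small (7 * R ^ 2 + c * (κ * e / 2)) (c * c * (η / 2) ^ 2) (by positivity)]
      with n ⟨hcb, hcb'⟩ ht₁ ht₂ ht₃ hen
    obtain ⟨hb0, hb1⟩ := hbt.b_mem n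
    obtain ⟨ht0, ht1⟩ := hbt.t_mem n
    have hTx : dist (T (x n)) q ≤ R := by
      have := hT.dist_le_mul (x n) q
      rw [hq.eq, NNReal.coe_one, one_mul] at this
      exact this.trans (hR n)
    rcases lt_or_ge (dist (x n) (T (x n))) η with hlt | hge
    -- `T xₙ` is almost fixed as well, so it is not much closer to `f q` than `q` is.
    · have hTT : dist (T (x n)) (T (T (x n))) < η := by
        have := hT.dist_le_mul (x n) (T (x n))
        rw [NNReal.coe_one, one_mul] at this
        exact this.trans_lt hlt
      have e₁ := hdemi (T (x n)) hTx hTT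
      rw [dist_comm q (f q)] at e₁
      have e₂ : t n * (dist (f q) q ^ 2 - dist (T (x n)) (f q) ^ 2 + 6 * R ^ 2 * t n) ≤
          t n * (κ * e / 2) := mul_le_mul_of_nonneg_left (by linarith) ht0.le
      have e₃ : κ * t n * e ≤ κ * t n * dist (x n) q ^ 2 :=
        mul_le_mul_of_nonneg_left hen (by positivity)
      have e₄ : dist (y n) q ^ 2 ≤ dist (x n) q ^ 2 - t n * (κ * e / 2) := by linarith [hy n]
      have e₅ := mul_le_mul_of_nonneg_left e₄ (sub_nonneg.2 hb1.le)
      have e₆ : 0 ≤ b n * (1 - b n) * dist (x n) (y n) ^ 2 :=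
        mul_nonneg (mul_nonneg hb0.le (sub_nonneg.2 hb1.le)) (sq_nonneg _)
      have e₇ : c * (t n * (κ * e / 2)) ≤ (1 - b n) * (t n * (κ * e / 2)) :=
        mul_le_mul_of_nonneg_right hcb' (by positivity)
      linarith [hx n]
    -- `yₙ` is close to `T xₙ`, hence not close to `xₙ`.
    · have hyT : dist (y n) (T (x n)) ≤ 3 * R * t n := by
        obtain ⟨S, -, -, -, hd⟩ := h.y_eq n
        have hfx := hf.dist_le_mul (x n) q
        have : (k : ℝ) * dist (x n) q ≤ 1 * R :=
          mul_le_mul (by linarith) (hR n) dist_nonneg (by simp)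
        have : dist (f (x n)) (T (x n)) ≤ 3 * R := by
          linarith [dist_triangle (f (x n)) (f q) q, dist_triangle_right (f (x n)) (T (x n)) q]
        rw [hd, mul_comm (3 * R)]
        exact mul_le_mul_of_nonneg_left this ht0.le
      have hxy : η / 2 ≤ dist (x n) (y n) := by
        linarith [dist_triangle (x n) (y n) (T (x n))]
      have e₁ : c * c * (η / 2) ^ 2 ≤ b n * (1 - b n) * dist (x n) (y n) ^ 2 := by gcongr
      have e₂ := mul_le_mul_of_nonneg_left (hy' n) (sub_nonneg.2 hb1.le)
      have e₃ : 0 ≤ b n * (7 * R ^ 2 * t n) := by positivity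
      linarith [hx n]
  rw [tendsto_iff_dist_tendsto_zero]
  simpa [Real.sqrt_sq] using hsq.sqrt

end Iteration

/-! ### The projection as a set, and its dependence on the point -/

/-- The variational inequality characterises the metric projection `p` of `w`. -/
theorem metricProj_eq_singleton {X : Type*} [MetricSpace X] {K : Set X} {w p : X} (hp : p ∈ K)
    (h : ∀ z ∈ K, dist p w ^ 2 + dist p z ^ 2 ≤ dist z w ^ 2) : metricProj K w = {p} := by
  have hinf : Metric.infDist w K = dist w p := by
    refine le_antisymm (Metric.infDist_le_dist_of_mem hp) ?_
    rw [Metric.le_infDist ⟨p, hp⟩]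
    intro z hz
    rw [dist_comm w p, dist_comm w z]
    exact le_of_sq_le_sq (by linarith [h z hz, sq_nonneg (dist p z)]) dist_nonneg
  ext z
  simp only [metricProj, hinf, Set.mem_ofPred_eq, Set.mem_singleton_iff]
  refine ⟨fun ⟨hz, hd⟩ => ?_, by rintro rfl; exact ⟨hp, rfl⟩⟩
  have h₁ := h z hz
  rw [dist_comm z w, hd, dist_comm w p] at h₁
  have h₂ : dist p z = 0 :=
    pow_eq_zero_iff two_ne_zero |>.1 (le_antisymm (by linarith) (sq_nonneg _))
  exact (dist_eq_zero.1 h₂).symm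

/-- Points satisfying the variational inequality depend on `w` in a nonexpansive way. -/
theorem IsCATZero.dist_projection_le {X : Type*} [MetricSpace X] (hX : IsCATZero X) {K : Set X}
    {w w' p p' : X} (hp : p ∈ K) (hp' : p' ∈ K)
    (h : ∀ z ∈ K, dist p w ^ 2 + dist p z ^ 2 ≤ dist z w ^ 2)
    (h' : ∀ z ∈ K, dist p' w' ^ 2 + dist p' z ^ 2 ≤ dist z w' ^ 2) :
    dist p p' ≤ dist w w' := by
  refine le_of_sq_le_sq ?_ dist_nonneg
  have h₁ := h p' hp'
  have h₂ := h' p hp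
  have h₃ := hX.quadrilateral w w' p p'
  rw [dist_comm p w, dist_comm p' w] at h₁
  rw [dist_comm p' w', dist_comm p w', dist_comm p' p] at h₂
  linarith

end ViscosityCAT

theorem theorem4p3 {C : Type*} [MetricSpace C] [CompleteSpace C]
    (hC : ViscosityCAT.IsCATZero C) (hN : ViscosityCAT.HasNProperty C)
    (T : C → C) (hT : LipschitzWith 1 T) (hFix : (Function.fixedPoints T).Nonempty)
    (f : C → C) (k : NNReal) (hk : (k : ℝ) < 1 / 2) (hf : LipschitzWith k f) :
    ∃ q : C,
      (q ∈ Function.fixedPoints T ∧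
        ViscosityCAT.metricProj (Function.fixedPoints T) (f q) = {q}) ∧
      (∀ q' : C, q' ∈ Function.fixedPoints T →
        ViscosityCAT.metricProj (Function.fixedPoints T) (f q') = {q'} → q' = q) ∧
      (∀ (u : C) (b t : ℕ → ℝ), ViscosityCAT.AdmissibleParameters b t →
        ∀ x y : ℕ → C, ViscosityCAT.IsViscosityIteration T f b t u x y →
          Tendsto x atTop (𝓝 q)) := by
  choose P hPmem hP using ViscosityCAT.exists_projection_fixedPoints hC hT hFix
  have hk1 : k < 1 := by
    rw [← NNReal.coe_lt_coe, NNReal.coe_one]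
    linarith
  have : Nonempty C := hFix.to_type
  have hcontr : ContractingWith k (fun z => P (f z)) :=
    ⟨hk1, LipschitzWith.of_dist_le_mul fun z z' =>
      (hC.dist_projection_le (hPmem _) (hPmem _) (hP _) (hP _)).trans (hf.dist_le_mul z z')⟩
  have hPq : P (f hcontr.fixedPoint) = hcontr.fixedPoint := hcontr.fixedPoint_isFixedPt
  have hproj := fun w => ViscosityCAT.metricProj_eq_singleton (hPmem w) (hP w)
  have hqF := hPmem (f hcontr.fixedPoint)
  have hqV := hP (f hcontr.fixedPoint)
  have hqP := hproj (f hcontr.fixedPoint)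
  rw [hPq] at hqF hqV hqP
  refine ⟨hcontr.fixedPoint, ⟨hqF, hqP⟩, fun q' _ hq' => ?_, fun u b t hbt x y h => ?_⟩
  · rw [hproj, Set.singleton_eq_singleton_iff] at hq'
    exact hcontr.fixedPoint_unique hq'
  · exact h.tendsto hC hT hk hf hqF (fun z hz => by
      linarith [hqV z hz, sq_nonneg (dist hcontr.fixedPoint z)]) hbt
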